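/- For a left cancellative semigroup $P$ with unit, and for $X\subseteq P$, $p\in P$, put $pX=\{px : x\in X\}$ and $p^{-1}X=\{y\in P : py\in X\}$. Let $\mathcal J_P$ be the smallest family of right ideals of $P$ that contains $P$ and $\emptyset$ and is closed under $X\mapsto pX$, $X\mapsto p^{-1}X$ ($p\in P$) and finite intersections. The full semigroup C*-algebra $C^*(P)$ is the universal C*-algebra generated by isometries $\{v_p : p\in P\}$ and projections $\{e_X : X\in\mathcal J_P\}$ subject to the relations $$v_{pq}=v_pv_q,\qquad v_pe_Xv_p^*=e_{pX},\qquad e_P=1,\qquad e_\emptyset=0,\qquad e_{X\cap Y}=e_Xe_Y$$ for all $p,q\in P$ and $X,Y\in\mathcal J_P$. For an integral domain $R$, the $ax+b$-semigroup $P_R$ is the set $\{(b,a) : b\in R,\ a\in R\setminus\{0\}\}$ with the multiplication $(b,a)(d,c)=(b+ad,ac)$; it is left cancellative and has the unit $(0,1)$. **Corollary.** Let $\phi:R\to S$ be an injective ring homomorphism between integral domains such that the quotient $S/\phi(R)$ of the $\phi(R)$-module $S$ by its submodule $\phi(R)$ is a flat $\phi(R)$-module. Let $\varphi:P_R\to P_S$,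 $\varphi(b,a)=(\phi(b),\phi(a))$, be the semigroup homomorphism induced by $\phi$. Then there is a unital *-homomorphism $\Phi:C^*(P_R)\to C^*(P_S)$ with $\Phi(v_p)=v_{\varphi(p)}$ for all $p\in P_R$. -/

import Mathlib

/-! ### Universal C*-algebras of generators and relations -/

/-- The free unital complex *-algebra on `X`: complex combinations of words in the letters
`(x, false)`, standing for `x`, and `(x, true)`, standing for `x*`. -/
def FreeStarAlgebra (X : Type*) : Type _ := MonoidAlgebra ℂ (FreeMonoid (X × Bool))

namespace FreeStarAlgebra

variable {X : Type*}

noncomputable instance : Ring (FreeStarAlgebra X) :=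
  inferInstanceAs (Ring (MonoidAlgebra ℂ (FreeMonoid (X × Bool))))

noncomputable instance : Algebra ℂ (FreeStarAlgebra X) :=
  inferInstanceAs (Algebra ℂ (MonoidAlgebra ℂ (FreeMonoid (X × Bool))))

/-- The letter `x` (for `b = false`) or `x*` (for `b = true`). -/
noncomputable def letter (x : X) (b : Bool) : FreeStarAlgebra X :=
  MonoidAlgebra.of ℂ (FreeMonoid (X × Bool)) (FreeMonoid.of (x, b))

/-- The generator `x`. -/
noncomputable def gen (x : X) : FreeStarAlgebra X := letter x false

/-- The conjugate-linear anti-multiplicative map that exchanges `x` and `x*`. -/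
noncomputable def starHom (X : Type*) : FreeStarAlgebra X →+* (FreeStarAlgebra X)ᵐᵒᵖ :=
  MonoidAlgebra.liftNCRingHom
    ((algebraMap ℂ (FreeStarAlgebra X)ᵐᵒᵖ).comp (starRingEnd ℂ))
    (FreeMonoid.lift fun w : X × Bool => MulOpposite.op (letter w.1 (!w.2)))
    (fun r _ => Algebra.commutes (starRingEnd ℂ r) _)

lemma starHom_letter (x : X) (b : Bool) :
    starHom X (letter x b) = MulOpposite.op (letter x (!b)) := by
  simp only [starHom, letter, MonoidAlgebra.of_apply]
  erw [MonoidAlgebra.liftNC_single]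
  simp

lemma starHom_algebraMap (r : ℂ) :
    starHom X (algebraMap ℂ _ r) =
      MulOpposite.op (algebraMap ℂ (FreeStarAlgebra X) (starRingEnd ℂ r)) := by
  have h : (algebraMap ℂ (FreeStarAlgebra X) r) =
      (MonoidAlgebra.single (1 : FreeMonoid (X × Bool)) r : MonoidAlgebra ℂ _) := rfl
  rw [h]
  simp only [starHom]
  erw [MonoidAlgebra.liftNC_single]
  simp

/-- Induction on the free *-algebra: scalars, letters, sums and products. -/
lemma induction {p : FreeStarAlgebra X → Prop}
    (scalar : ∀ r : ℂ, p (algebraMap ℂ _ r)) (letter : ∀ x b, p (letter x b))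
    (add : ∀ a b, p a → p b → p (a + b)) (mul : ∀ a b, p a → p b → p (a * b))
    (a : FreeStarAlgebra X) : p a := by
  refine MonoidAlgebra.induction_on (motive := p) (R := ℂ) (M := FreeMonoid (X × Bool)) a ?_ ?_ ?_
  · intro w
    induction w using FreeMonoid.recOn with
    | one =>
      have := scalar 1
      rw [map_one] at this
      exact this
    | of_mul w ws h =>
      rw [map_mul]
      exact mul _ _ (letter w.1 w.2) h
  · exact fun a b => add a b
  · intro r a ha
    rw [Algebra.smul_def]
    exact mul _ _ (scalar r) ha

noncomputable instance : StarRing (FreeStarAlgebra X) where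
  star a := (starHom X a).unop
  star_involutive a := by
    induction a using induction with
    | scalar r => simp [starHom_algebraMap]
    | letter x b => simp [starHom_letter]
    | add a b ha hb => simp [ha, hb]
    | mul a b ha hb => simp [ha, hb]
  star_mul a b := by simp
  star_add a b := by simp

lemma star_def (a : FreeStarAlgebra X) : star a = (starHom X a).unop := rfl

lemma star_letter (x : X) (b : Bool) : star (letter x b) = letter x (!b) := by
  simp [star_def, starHom_letter]

instance : StarModule ℂ (FreeStarAlgebra X) where
  star_smul r a := by
    rw [Algebra.smul_def, star_mul, star_def (algebraMap ℂ _ r), starHom_algebraMap,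
      MulOpposite.unop_op, Algebra.smul_def]
    exact (Algebra.commutes _ _).symm

end FreeStarAlgebra

/-- A C*-seminorm on a complex *-algebra. -/
structure CStarSeminorm (A : Type*) [Ring A] [Algebra ℂ A] [StarRing A]
    extends Seminorm ℂ A where
  mul_le' : ∀ a b, toFun (a * b) ≤ toFun a * toFun b
  star_mul_self' : ∀ a, toFun (star a * a) = toFun a * toFun a

namespace CStarSeminorm

variable {A : Type*} [Ring A] [Algebra ℂ A] [StarRing A] (q : CStarSeminorm A)

lemma nonneg (a : A) : 0 ≤ q.toSeminorm a := apply_nonneg q.toSeminorm a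

lemma mul_le (a b : A) : q.toSeminorm (a * b) ≤ q.toSeminorm a * q.toSeminorm b :=
  q.mul_le' a b

lemma star_mul_self (a : A) :
    q.toSeminorm (star a * a) = q.toSeminorm a * q.toSeminorm a := q.star_mul_self' a

lemma le_star (a : A) : q.toSeminorm a ≤ q.toSeminorm (star a) := by
  rcases (q.nonneg a).eq_or_lt with h | h
  · rw [← h]; exact q.nonneg _
  · have h1 := q.star_mul_self a
    have h2 := q.mul_le (star a) a
    exact le_of_mul_le_mul_right (h1 ▸ h2) h

lemma star_eq (a : A) : q.toSeminorm (star a) = q.toSeminorm a :=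
  le_antisymm (by simpa using q.le_star (star a)) (q.le_star a)

lemma one_le : q.toSeminorm (1 : A) ≤ 1 := by
  have h := q.star_mul_self 1
  rw [star_one, one_mul] at h
  nlinarith [sq_nonneg (q.toSeminorm (1 : A) - 1)]

noncomputable instance : Zero (CStarSeminorm A) where
  zero :=
    { (0 : Seminorm ℂ A) with
      mul_le' := fun _ _ => (mul_zero (0 : ℝ)).ge
      star_mul_self' := fun _ => (mul_zero (0 : ℝ)).symm }

lemma zero_apply (a : A) : (0 : CStarSeminorm A).toSeminorm a = 0 := rfl

end CStarSeminorm

/-- The C*-seminorms on the free *-algebra on `X` that vanish on the relations `Rel`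
(a relation `a = b` being recorded as the element `a - b`). -/
def AdmissibleSeminorm {X : Type*} (Rel : Set (FreeStarAlgebra X)) : Type _ :=
  {q : CStarSeminorm (FreeStarAlgebra X) // ∀ r ∈ Rel, q.toSeminorm r = 0}

/-- The relations bound the norm of every generator, which is the condition for the
universal C*-algebra to exist. -/
class BoundedRelations {X : Type*} (Rel : Set (FreeStarAlgebra X)) : Prop where
  bounded : ∀ x : X, ∃ C : ℝ, ∀ q : AdmissibleSeminorm Rel,
    q.1.toSeminorm (FreeStarAlgebra.gen x) ≤ C

section Universal

open UniformSpace

variable {X : Type*} (Rel : Set (FreeStarAlgebra X))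

instance : Nonempty (AdmissibleSeminorm Rel) := ⟨⟨0, fun _ _ => rfl⟩⟩

lemma AdmissibleSeminorm.bddAbove [BoundedRelations Rel] (a : FreeStarAlgebra X) :
    BddAbove (Set.range fun q : AdmissibleSeminorm Rel => q.1.toSeminorm a) := by
  suffices h : ∃ C : ℝ, ∀ q : AdmissibleSeminorm Rel, q.1.toSeminorm a ≤ C by
    obtain ⟨C, hC⟩ := h
    exact ⟨C, by rintro _ ⟨q, rfl⟩; exact hC q⟩
  induction a using FreeStarAlgebra.induction with
  | scalar r =>
    refine ⟨‖r‖, fun q => ?_⟩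
    rw [Algebra.algebraMap_eq_smul_one, map_smul_eq_mul]
    exact mul_le_of_le_one_right (norm_nonneg r) q.1.one_le
  | letter x b =>
    obtain ⟨C, hC⟩ := BoundedRelations.bounded (Rel := Rel) x
    refine ⟨C, fun q => ?_⟩
    cases b with
    | false => exact hC q
    | true =>
      have h := q.1.star_eq (FreeStarAlgebra.letter x false)
      rw [FreeStarAlgebra.star_letter] at h
      exact h.le.trans (hC q)
  | add a b ha hb =>
    obtain ⟨C, hC⟩ := ha
    obtain ⟨D, hD⟩ := hb
    exact ⟨C + D, fun q => (map_add_le_add _ _ _).trans (add_le_add (hC q) (hD q))⟩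
  | mul a b ha hb =>
    obtain ⟨C, hC⟩ := ha
    obtain ⟨D, hD⟩ := hb
    exact ⟨C * D, fun q => (q.1.mul_le a b).trans
      (mul_le_mul (hC q) (hD q) (q.1.nonneg b) ((q.1.nonneg a).trans (hC q)))⟩

/-- The supremum of all admissible C*-seminorms. -/
noncomputable def universalSeminorm (a : FreeStarAlgebra X) : ℝ :=
  ⨆ q : AdmissibleSeminorm Rel, q.1.toSeminorm a

lemma le_universalSeminorm [BoundedRelations Rel] (q : AdmissibleSeminorm Rel)
    (a : FreeStarAlgebra X) : q.1.toSeminorm a ≤ universalSeminorm Rel a :=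
  le_ciSup (AdmissibleSeminorm.bddAbove Rel a) q

lemma universalSeminorm_le {a : FreeStarAlgebra X} {C : ℝ}
    (h : ∀ q : AdmissibleSeminorm Rel, q.1.toSeminorm a ≤ C) : universalSeminorm Rel a ≤ C :=
  ciSup_le h

lemma universalSeminorm_nonneg [BoundedRelations Rel] (a : FreeStarAlgebra X) :
    0 ≤ universalSeminorm Rel a :=
  (CStarSeminorm.nonneg _ a).trans (le_universalSeminorm Rel ⟨0, fun _ _ => rfl⟩ a)

lemma universalSeminorm_smul_le [BoundedRelations Rel] (r : ℂ) (a : FreeStarAlgebra X) :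
    universalSeminorm Rel (r • a) ≤ ‖r‖ * universalSeminorm Rel a :=
  universalSeminorm_le Rel fun q => by
    rw [map_smul_eq_mul]
    exact mul_le_mul_of_nonneg_left (le_universalSeminorm Rel q a) (norm_nonneg r)

lemma universalSeminorm_star_le [BoundedRelations Rel] (a : FreeStarAlgebra X) :
    universalSeminorm Rel (star a) ≤ universalSeminorm Rel a :=
  universalSeminorm_le Rel fun q => by
    rw [q.1.star_eq]
    exact le_universalSeminorm Rel q a

lemma universalSeminorm_mul_self_le [BoundedRelations Rel] (a : FreeStarAlgebra X) :
    universalSeminorm Rel a * universalSeminorm Rel a ≤ universalSeminorm Rel (star a * a) := by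
  have h : universalSeminorm Rel a ≤ Real.sqrt (universalSeminorm Rel (star a * a)) :=
    universalSeminorm_le Rel fun q => Real.le_sqrt_of_sq_le <| by
      rw [sq, ← q.1.star_mul_self]
      exact le_universalSeminorm Rel q _
  calc _ ≤ _ := mul_self_le_mul_self (universalSeminorm_nonneg Rel a) h
    _ = _ := Real.mul_self_sqrt (universalSeminorm_nonneg Rel _)

/-- The universal seminorm as a ring seminorm. -/
noncomputable def universalRingSeminorm [BoundedRelations Rel] :
    RingSeminorm (FreeStarAlgebra X) where
  toFun := universalSeminorm Rel
  map_zero' := le_antisymm (universalSeminorm_le Rel fun q => (map_zero _).le)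
    (universalSeminorm_nonneg Rel 0)
  add_le' a b := universalSeminorm_le Rel fun q => (map_add_le_add _ _ _).trans
    (add_le_add (le_universalSeminorm Rel q a) (le_universalSeminorm Rel q b))
  neg' a := by simp [universalSeminorm, map_neg_eq_map]
  mul_le' a b := universalSeminorm_le Rel fun q => (q.1.mul_le a b).trans
    (mul_le_mul (le_universalSeminorm Rel q a) (le_universalSeminorm Rel q b)
      (q.1.nonneg b) (universalSeminorm_nonneg Rel a))

/-- The free *-algebra on `X`, seminormed by the universal seminorm. -/
def RelationAlgebra {X : Type*} (_ : Set (FreeStarAlgebra X)) : Type _ := FreeStarAlgebra X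

namespace RelationAlgebra

noncomputable instance : Ring (RelationAlgebra Rel) :=
  inferInstanceAs (Ring (FreeStarAlgebra X))

noncomputable instance : Algebra ℂ (RelationAlgebra Rel) :=
  inferInstanceAs (Algebra ℂ (FreeStarAlgebra X))

noncomputable instance : StarRing (RelationAlgebra Rel) :=
  inferInstanceAs (StarRing (FreeStarAlgebra X))

instance : StarModule ℂ (RelationAlgebra Rel) :=
  inferInstanceAs (StarModule ℂ (FreeStarAlgebra X))

variable [BoundedRelations Rel]

noncomputable instance : SeminormedRing (RelationAlgebra Rel) :=
  { (inferInstance : Ring (RelationAlgebra Rel)),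
    (universalRingSeminorm Rel).toAddGroupSeminorm.toSeminormedAddCommGroup with
    norm_mul_le := (universalRingSeminorm Rel).mul_le' }

lemma norm_def (a : RelationAlgebra Rel) : ‖a‖ = universalSeminorm Rel a := rfl

noncomputable instance : NormedAlgebra ℂ (RelationAlgebra Rel) where
  norm_smul_le := universalSeminorm_smul_le Rel

instance : NormedStarGroup (RelationAlgebra Rel) where
  norm_star_le := universalSeminorm_star_le Rel

end RelationAlgebra

/-- The universal C*-algebra generated by `X` subject to the relations `Rel`: the Hausdorff
completion of the free *-algebra for the largest C*-seminorm that vanishes on `Rel`. -/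
def UniversalCStarAlgebra [BoundedRelations Rel] : Type _ := Completion (RelationAlgebra Rel)

namespace UniversalCStarAlgebra

variable [BoundedRelations Rel]

noncomputable instance : NormedRing (UniversalCStarAlgebra Rel) :=
  inferInstanceAs (NormedRing (Completion (RelationAlgebra Rel)))

instance : CompleteSpace (UniversalCStarAlgebra Rel) :=
  inferInstanceAs (CompleteSpace (Completion (RelationAlgebra Rel)))

noncomputable instance : NormedAlgebra ℂ (UniversalCStarAlgebra Rel) :=
  { (inferInstance : Algebra ℂ (Completion (RelationAlgebra Rel))) with
    norm_smul_le := fun r x =>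
      norm_smul_le (α := ℂ) (β := Completion (RelationAlgebra Rel)) r x }

variable {Rel} in
/-- The class of an element of the free *-algebra. -/
noncomputable def mk (a : FreeStarAlgebra X) : UniversalCStarAlgebra Rel :=
  ((show RelationAlgebra Rel from a : RelationAlgebra Rel) : Completion (RelationAlgebra Rel))

noncomputable instance : Star (UniversalCStarAlgebra Rel) where
  star := Completion.map (star : RelationAlgebra Rel → RelationAlgebra Rel)

lemma uniformContinuous_star :
    UniformContinuous (star : RelationAlgebra Rel → RelationAlgebra Rel) :=
  (starNormedAddGroupHom : NormedAddGroupHom (RelationAlgebra Rel) _).uniformContinuous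

lemma star_mk (a : FreeStarAlgebra X) :
    star (mk a : UniversalCStarAlgebra Rel) = mk (star a) :=
  Completion.map_coe (uniformContinuous_star Rel) _

lemma continuous_star : Continuous (star : UniversalCStarAlgebra Rel → UniversalCStarAlgebra Rel) :=
  Completion.continuous_map

lemma mk_add (a b : FreeStarAlgebra X) :
    (mk (a + b) : UniversalCStarAlgebra Rel) = mk a + mk b :=
  Completion.coe_add (α := RelationAlgebra Rel) _ _

lemma mk_mul (a b : FreeStarAlgebra X) :
    (mk (a * b) : UniversalCStarAlgebra Rel) = mk a * mk b :=
  Completion.coe_mul (α := RelationAlgebra Rel) _ _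

lemma mk_smul (r : ℂ) (a : FreeStarAlgebra X) :
    (mk (r • a) : UniversalCStarAlgebra Rel) = r • mk a := by
  have h := Completion.coe_smul (M := ℂ) (X := RelationAlgebra Rel) r a
  exact h

lemma norm_mk (a : FreeStarAlgebra X) :
    ‖(mk a : UniversalCStarAlgebra Rel)‖ = universalSeminorm Rel a :=
  Completion.norm_coe (E := RelationAlgebra Rel) _

lemma induction {p : UniversalCStarAlgebra Rel → Prop} (hp : IsClosed {x | p x})
    (h : ∀ a, p (mk a)) (x : UniversalCStarAlgebra Rel) : p x :=
  Completion.induction_on x hp h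

lemma induction₂ {p : UniversalCStarAlgebra Rel → UniversalCStarAlgebra Rel → Prop}
    (hp : IsClosed {x : UniversalCStarAlgebra Rel × UniversalCStarAlgebra Rel | p x.1 x.2})
    (h : ∀ a b, p (mk a) (mk b)) (x y : UniversalCStarAlgebra Rel) : p x y :=
  Completion.induction_on₂ x y hp h

lemma star_star_aux (x : UniversalCStarAlgebra Rel) : star (star x) = x := by
  have hs := continuous_star Rel
  refine induction Rel (p := fun x => star (star x) = x)
    (isClosed_eq (hs.comp hs) continuous_id) (fun a => ?_) x
  rw [star_mk, star_mk, star_star]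

lemma star_mul_aux (x y : UniversalCStarAlgebra Rel) : star (x * y) = star y * star x := by
  have hs := continuous_star Rel
  refine induction₂ Rel (p := fun x y => star (x * y) = star y * star x)
    (isClosed_eq (hs.comp continuous_mul)
      ((hs.comp continuous_snd).mul (hs.comp continuous_fst))) (fun a b => ?_) x y
  rw [← mk_mul, star_mk, star_mk, star_mk, ← mk_mul, star_mul]

lemma star_add_aux (x y : UniversalCStarAlgebra Rel) : star (x + y) = star x + star y := by
  have hs := continuous_star Rel
  refine induction₂ Rel (p := fun x y => star (x + y) = star x + star y)
    (isClosed_eq (hs.comp continuous_add)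
      ((hs.comp continuous_fst).add (hs.comp continuous_snd))) (fun a b => ?_) x y
  rw [← mk_add, star_mk, star_mk, star_mk, ← mk_add, star_add]

lemma star_smul_aux (r : ℂ) (x : UniversalCStarAlgebra Rel) : star (r • x) = star r • star x := by
  have hs := continuous_star Rel
  refine induction Rel (p := fun x => star (r • x) = star r • star x)
    (isClosed_eq (hs.comp (continuous_const_smul r)) (hs.const_smul (star r))) (fun a => ?_) x
  rw [← mk_smul, star_mk, star_mk, ← mk_smul, star_smul]

lemma norm_aux (x : UniversalCStarAlgebra Rel) : ‖x‖ * ‖x‖ ≤ ‖star x * x‖ := by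
  have hs := continuous_star Rel
  refine induction Rel (p := fun x => ‖x‖ * ‖x‖ ≤ ‖star x * x‖)
    (isClosed_le (continuous_norm.mul continuous_norm) (hs.mul continuous_id).norm)
    (fun a => ?_) x
  rw [star_mk, ← mk_mul, norm_mk, norm_mk]
  exact universalSeminorm_mul_self_le Rel a

noncomputable instance : StarRing (UniversalCStarAlgebra Rel) where
  star_involutive := star_star_aux Rel
  star_mul := star_mul_aux Rel
  star_add := star_add_aux Rel

instance : StarModule ℂ (UniversalCStarAlgebra Rel) where
  star_smul := star_smul_aux Rel

instance : CStarRing (UniversalCStarAlgebra Rel) where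
  norm_mul_self_le := norm_aux Rel

noncomputable instance : CStarAlgebra (UniversalCStarAlgebra Rel) where
  star_smul := star_smul_aux Rel

end UniversalCStarAlgebra

end Universal

/-! ### Constructible right ideals and the full semigroup C*-algebra -/

section Semigroup

variable (P : Type*) [Monoid P]

variable {P} in
/-- The smallest family of subsets of `P` that contains `P` and `∅` and is closed under images
and pre-images under left multiplications and under finite intersections. -/
inductive IsConstructible : Set P → Prop
  | univ : IsConstructible Set.univ
  | empty : IsConstructible ∅
  | image (p : P) {X : Set P} : IsConstructible X → IsConstructible ((fun x => p * x) '' X)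
  | preimage (p : P) {X : Set P} : IsConstructible X → IsConstructible ((fun x => p * x) ⁻¹' X)
  | inter {X Y : Set P} : IsConstructible X → IsConstructible Y → IsConstructible (X ∩ Y)

variable {P} in
/-- Every constructible set is a right ideal, so these sets also form the smallest such family
of right ideals. -/
lemma IsConstructible.mul_mem {X : Set P} (hX : IsConstructible X) :
    ∀ x ∈ X, ∀ p : P, x * p ∈ X := by
  induction hX with
  | univ => exact fun _ _ _ => Set.mem_univ _
  | empty => exact fun _ h => h.elim
  | image q _ ih =>
    rintro _ ⟨y, hy, rfl⟩ p
    exact ⟨y * p, ih y hy p, (mul_assoc q y p).symm⟩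
  | preimage q _ ih =>
    intro x hx p
    have := ih _ hx p
    rwa [mul_assoc] at this
  | inter _ _ h₁ h₂ => exact fun x hx p => ⟨h₁ x hx.1 p, h₂ x hx.2 p⟩

/-- The family of constructible right ideals of `P`. -/
def ConstructibleIdeal : Type _ := {X : Set P // IsConstructible X}

/-- The generators of the full semigroup C*-algebra of `P`. -/
inductive SemigroupGen : Type _
  | v (p : P)
  | e (X : ConstructibleIdeal P)

namespace SemigroupCStar

variable {P}

/-- The generator `v_p` of the free *-algebra. -/
noncomputable def genV (p : P) : FreeStarAlgebra (SemigroupGen P) := FreeStarAlgebra.gen (.v p)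

/-- The generator `e_X` of the free *-algebra. -/
noncomputable def genE (X : Set P) (hX : IsConstructible X) : FreeStarAlgebra (SemigroupGen P) :=
  FreeStarAlgebra.gen (.e ⟨X, hX⟩)

variable (P) in
/-- The relations of the full semigroup C*-algebra: the `v_p` are isometries, the `e_X` are
projections, `v_{pq} = v_p v_q`, `v_p e_X v_p* = e_{pX}`, `e_P = 1`, `e_∅ = 0` and
`e_{X ∩ Y} = e_X e_Y`. -/
inductive IsRelation : FreeStarAlgebra (SemigroupGen P) → Prop
  | isometry (p : P) : IsRelation (star (genV p) * genV p - 1)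
  | selfAdjoint (X : Set P) (hX : IsConstructible X) : IsRelation (star (genE X hX) - genE X hX)
  | idempotent (X : Set P) (hX : IsConstructible X) :
      IsRelation (genE X hX * genE X hX - genE X hX)
  | mul (p q : P) : IsRelation (genV (p * q) - genV p * genV q)
  | conj (p : P) (X : Set P) (hX : IsConstructible X) :
      IsRelation (genV p * genE X hX * star (genV p) - genE _ (hX.image p))
  | univ : IsRelation (genE Set.univ .univ - 1)
  | empty : IsRelation (genE ∅ .empty)
  | inter (X Y : Set P) (hX : IsConstructible X) (hY : IsConstructible Y) :
      IsRelation (genE (X ∩ Y) (hX.inter hY) - genE X hX * genE Y hY)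

variable (P) in
/-- The set of all these relations. -/
def relations : Set (FreeStarAlgebra (SemigroupGen P)) := {a | IsRelation P a}

instance : BoundedRelations (relations P) where
  bounded x := by
    have key : ∀ t : ℝ, 0 ≤ t → t * t ≤ 1 → t ≤ 1 := fun t _ h => by nlinarith
    refine ⟨1, fun q => ?_⟩
    have heq : ∀ a b : FreeStarAlgebra (SemigroupGen P), q.1.toSeminorm (a - b) = 0 →
        q.1.toSeminorm a ≤ q.1.toSeminorm b := fun a b h => by
      have := map_add_le_add q.1.toSeminorm (a - b) b
      rwa [sub_add_cancel, h, zero_add] at this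
    cases x with
    | v p =>
      refine key _ (q.1.nonneg _) ?_
      rw [← q.1.star_mul_self]
      exact (heq _ _ (q.2 _ (IsRelation.isometry p))).trans q.1.one_le
    | e X =>
      obtain ⟨X, hX⟩ := X
      change q.1.toSeminorm (genE X hX) ≤ 1
      have h1 := heq _ _ (q.2 _ (IsRelation.idempotent X hX))
      have h2 : q.1.toSeminorm (star (genE X hX) * genE X hX - genE X hX * genE X hX) = 0 := by
        rw [← sub_mul]
        refine le_antisymm ((q.1.mul_le _ _).trans ?_) (q.1.nonneg _)
        rw [q.2 _ (IsRelation.selfAdjoint X hX), zero_mul]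
      have h3 := (heq _ _ h2).trans h1
      rw [q.1.star_mul_self] at h3
      by_contra! h
      nlinarith

end SemigroupCStar

/-- The full semigroup C*-algebra `C*(P)`: the universal C*-algebra generated by isometries
`v_p`, `p ∈ P`, and projections `e_X`, `X` a constructible right ideal, subject to the relations
above. -/
abbrev SemigroupCStarAlgebra [IsLeftCancelMul P] : Type _ :=
  UniversalCStarAlgebra (SemigroupCStar.relations P)

variable {P} in
/-- The isometry `v_p ∈ C*(P)`. -/
noncomputable def SemigroupCStarAlgebra.v [IsLeftCancelMul P] (p : P) : SemigroupCStarAlgebra P :=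
  UniversalCStarAlgebra.mk (SemigroupCStar.genV p)

variable {P} in
/-- The projection `e_X ∈ C*(P)`. -/
noncomputable def SemigroupCStarAlgebra.e [IsLeftCancelMul P] (X : ConstructibleIdeal P) :
    SemigroupCStarAlgebra P :=
  UniversalCStarAlgebra.mk (SemigroupCStar.genE X.1 X.2)

end Semigroup

/-! ### The `ax+b`-semigroup -/

/-- The `ax+b`-semigroup of `R`: pairs `(b, a)` with `b ∈ R` and `a ∈ R \ {0}`. -/
@[ext]
structure AxbSemigroup (R : Type*) [CommRing R] where
  b : R
  a : R
  a_ne_zero : a ≠ 0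

namespace AxbSemigroup

variable {R S : Type*} [CommRing R] [IsDomain R] [CommRing S] [IsDomain S]

/-- The multiplication is `(b, a) (d, c) = (b + a d, a c)`. -/
instance : Monoid (AxbSemigroup R) where
  mul x y := ⟨x.b + x.a * y.b, x.a * y.a, mul_ne_zero x.a_ne_zero y.a_ne_zero⟩
  one := ⟨0, 1, one_ne_zero⟩
  mul_assoc x y z := AxbSemigroup.ext
    (show x.b + x.a * y.b + x.a * y.a * z.b = x.b + x.a * (y.b + y.a * z.b) by ring)
    (mul_assoc x.a y.a z.a)
  one_mul x := AxbSemigroup.ext (show 0 + 1 * x.b = x.b by ring) (one_mul x.a)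
  mul_one x := AxbSemigroup.ext (show x.b + x.a * 0 = x.b by ring) (mul_one x.a)

instance : IsLeftCancelMul (AxbSemigroup R) where
  mul_left_cancel x y z h := by
    have hb : x.b + x.a * y.b = x.b + x.a * z.b := congrArg AxbSemigroup.b h
    have ha : x.a * y.a = x.a * z.a := congrArg AxbSemigroup.a h
    exact AxbSemigroup.ext (mul_left_cancel₀ x.a_ne_zero (add_left_cancel hb))
      (mul_left_cancel₀ x.a_ne_zero ha)

/-- The semigroup homomorphism `(b, a) ↦ (φ b, φ a)` induced by an injective ring
homomorphism `φ`. -/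
def map (φ : R →+* S) (hφ : Function.Injective φ) : AxbSemigroup R →* AxbSemigroup S where
  toFun x := ⟨φ x.b, φ x.a, (map_ne_zero_iff φ hφ).2 x.a_ne_zero⟩
  map_one' := AxbSemigroup.ext (map_zero φ) (map_one φ)
  map_mul' x y := AxbSemigroup.ext
    (show φ (x.b + x.a * y.b) = φ x.b + φ x.a * φ y.b by simp) (map_mul φ x.a y.a)

end AxbSemigroup

/-! By the universal property of `C*(P_R)`, it suffices to choose an image for each `e_X` so that
the relations hold. The choice is `e_{E(X)}`, where `E` extends constructible ideals from `P_R` to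
`P_S` and respects the whole semigroup, `∅`, left translates and intersections.

Every constructible ideal of `P_R` has the form `(r + I) × (I \ {0})`, and `E` sends it to `(φ r +
IS) × (IS \ {0})`. Translates are respected because extension of ideals is multiplicative.
Intersections carry the content. The cosets `r + I` and `s + J` meet exactly when `r - s ∈ I + J`,
and then they meet in a coset of `I ∩ J`. So two facts are needed: `(I ∩ J)S = IS ∩ JS`, and
`φ⁻¹(IS) = I`, which keeps disjoint cosets disjoint.

Both follow from flatness of `S / φ(R)`. A relation `∑ φ(f i) * s i = φ r` becomes a relation with
right-hand side zero in the quotient. The equational criterion trivializes it, and lifting back to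
`S` writes each `s i` as a combination of syzygies of `f` plus a correction from `R`
(`exists_factorization_of_flat_quotient`). -/

/-! ### The universal property -/

namespace FreeStarAlgebra

variable {X : Type*} {B : Type*} [Ring B] [Algebra ℂ B] [StarRing B]

/-- The *-homomorphism on the free *-algebra with prescribed values on the generators. -/
noncomputable def lift [StarModule ℂ B] (f : X → B) : FreeStarAlgebra X →⋆ₐ[ℂ] B :=
  let F : FreeStarAlgebra X →ₐ[ℂ] B :=
    MonoidAlgebra.lift ℂ B (FreeMonoid (X × Bool))
      (FreeMonoid.lift fun w : X × Bool => bif w.2 then star (f w.1) else f w.1)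
  have hF : ∀ x b, F (letter x b) = bif b then star (f x) else f x := fun x b => by
    refine (MonoidAlgebra.lift_of _ _).trans ?_
    simp
  { F with
    map_star' := fun a => by
      change F (star a) = star (F a)
      induction a using induction with
      | scalar r => simp only [Algebra.algebraMap_eq_smul_one, star_smul, map_smul, star_one, map_one]
      | letter x b => cases b <;> simp [star_letter, hF]
      | add a b ha hb => rw [star_add, map_add, ha, hb, map_add, star_add]
      | mul a b ha hb => rw [star_mul, map_mul, ha, hb, map_mul, star_mul] }

lemma lift_gen [StarModule ℂ B] (f : X → B) (x : X) : lift f (gen x) = f x := by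
  refine (MonoidAlgebra.lift_of _ _).trans ?_
  simp

end FreeStarAlgebra

/-- The C*-seminorm obtained by pulling back the norm along a *-homomorphism. -/
noncomputable def CStarSeminorm.ofStarAlgHom {A B : Type*} [Ring A] [Algebra ℂ A] [StarRing A]
    [CStarAlgebra B] (f : A →⋆ₐ[ℂ] B) : CStarSeminorm A where
  toSeminorm := (normSeminorm ℂ B).comp (f : A →ₐ[ℂ] B).toLinearMap
  mul_le' a b := by
    change ‖f (a * b)‖ ≤ ‖f a‖ * ‖f b‖
    rw [map_mul]
    exact norm_mul_le _ _
  star_mul_self' a := by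
    change ‖f (star a * a)‖ = ‖f a‖ * ‖f a‖
    rw [map_mul, map_star, CStarRing.norm_star_mul_self]

namespace UniversalCStarAlgebra

open UniformSpace

variable {X : Type*} {Rel : Set (FreeStarAlgebra X)} [BoundedRelations Rel]

lemma mk_eq_zero {a : FreeStarAlgebra X} (ha : a ∈ Rel) :
    (mk a : UniversalCStarAlgebra Rel) = 0 := by
  rw [← norm_le_zero_iff, norm_mk]
  exact universalSeminorm_le Rel fun q => (q.2 a ha).le

/-- Passage to the class as a *-homomorphism. -/
noncomputable def mkHom : FreeStarAlgebra X →⋆ₐ[ℂ] UniversalCStarAlgebra Rel where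
  toFun := mk
  map_one' := Completion.coe_one (RelationAlgebra Rel)
  map_mul' := mk_mul Rel
  map_zero' := Completion.coe_zero
  map_add' := mk_add Rel
  commutes' r := by
    rw [Algebra.algebraMap_eq_smul_one, mk_smul, Algebra.algebraMap_eq_smul_one]
    exact congrArg (r • ·) (Completion.coe_one (RelationAlgebra Rel))
  map_star' a := (star_mk Rel a).symm

lemma mkHom_apply (a : FreeStarAlgebra X) : (mkHom a : UniversalCStarAlgebra Rel) = mk a := rfl

variable {B : Type*} [CStarAlgebra B]

/-- The norm of `B` pulled back along the lift is itself an admissible seminorm, so the supremum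
dominates it. -/
lemma norm_lift_le (f : X → B) (hf : ∀ r ∈ Rel, FreeStarAlgebra.lift f r = 0)
    (a : FreeStarAlgebra X) : ‖FreeStarAlgebra.lift f a‖ ≤ universalSeminorm Rel a :=
  le_universalSeminorm Rel ⟨CStarSeminorm.ofStarAlgHom (FreeStarAlgebra.lift f), fun r hr => by
    change ‖FreeStarAlgebra.lift f r‖ = 0
    rw [hf r hr, norm_zero]⟩ a

/-- The universal property: elements of a C*-algebra that satisfy the relations define a unital
*-homomorphism on the universal C*-algebra. -/
theorem exists_lift (f : X → B) (hf : ∀ r ∈ Rel, FreeStarAlgebra.lift f r = 0) :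
    ∃ Φ : UniversalCStarAlgebra Rel →⋆ₐ[ℂ] B, ∀ a, Φ (mk a) = FreeStarAlgebra.lift f a := by
  let F : RelationAlgebra Rel →+* B :=
    ((FreeStarAlgebra.lift f : FreeStarAlgebra X →ₐ[ℂ] B) : FreeStarAlgebra X →+* B)
  -- Contractivity for the universal seminorm is what allows extension to the completion.
  have hF : Continuous F :=
    AddMonoidHomClass.continuous_of_bound F 1 fun a => by
      rw [one_mul]
      exact norm_lift_le f hf a
  let G : UniversalCStarAlgebra Rel →+* B := Completion.extensionHom F hF
  have hG : ∀ a, G (mk a) = FreeStarAlgebra.lift f a :=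
    Completion.extensionHom_coe (α := RelationAlgebra Rel) F hF
  have hGc : Continuous G := Completion.continuous_extension
  refine ⟨{ G with
    commutes' := fun r => ?_
    map_star' := fun x => ?_ }, hG⟩
  · change G (algebraMap ℂ _ r) = _
    rw [← AlgHomClass.commutes (mkHom (Rel := Rel)) r, mkHom_apply, hG, AlgHomClass.commutes]
  · change G (star x) = star (G x)
    refine induction Rel (p := fun x => G (star x) = star (G x))
      (isClosed_eq (hGc.comp (continuous_star Rel)) (continuous_id.star.comp hGc))
      (fun a => ?_) x
    rw [star_mk, hG, hG, map_star]

end UniversalCStarAlgebra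

namespace SemigroupCStarAlgebra

variable {P : Type*} [Monoid P] [IsLeftCancelMul P]

open UniversalCStarAlgebra SemigroupCStar

/-- A homomorphism of semigroups together with a compatible map of constructible ideals induces
a *-homomorphism of full semigroup C*-algebras. -/
theorem exists_starAlgHom {Q : Type*} [Monoid Q] [IsLeftCancelMul Q] (f : P →* Q)
    (E : Set P → Set Q) (hE : ∀ X, IsConstructible X → IsConstructible (E X))
    (univ : E Set.univ = Set.univ) (empty : E ∅ = ∅)
    (image : ∀ p X, IsConstructible X →
      E ((fun x => p * x) '' X) = (fun x => f p * x) '' E X)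
    (inter : ∀ X Y, IsConstructible X → IsConstructible Y → E (X ∩ Y) = E X ∩ E Y) :
    ∃ Φ : SemigroupCStarAlgebra P →⋆ₐ[ℂ] SemigroupCStarAlgebra Q, ∀ p, Φ (v p) = v (f p) := by
  let g : SemigroupGen P → FreeStarAlgebra (SemigroupGen Q)
    | .v p => genV (f p)
    | .e X => genE (E X.1) (hE X.1 X.2)
  let h : SemigroupGen P → SemigroupCStarAlgebra Q := fun x => mkHom (g x)
  have hV : ∀ p, FreeStarAlgebra.lift h (genV p) = mkHom (genV (f p)) :=
    fun p => FreeStarAlgebra.lift_gen h (.v p)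
  have hP : ∀ X hX, FreeStarAlgebra.lift h (genE X hX) = mkHom (genE (E X) (hE X hX)) :=
    fun X hX => FreeStarAlgebra.lift_gen h (.e ⟨X, hX⟩)
  -- `genE` carries a proof of constructibility, so an equality of sets is transported together with
  -- that proof.
  have hcongr : ∀ {X Y : Set Q} (hXY : X = Y) (hX : IsConstructible X) (hY : IsConstructible Y),
      genE X hX = genE Y hY := by
    rintro X _ rfl _ _
    rfl
  have hrel : ∀ {a : FreeStarAlgebra (SemigroupGen Q)}, IsRelation Q a →
      (mkHom a : SemigroupCStarAlgebra Q) = 0 := fun ha => mk_eq_zero ha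
  obtain ⟨Φ, hΦ⟩ := exists_lift (Rel := relations P) h (by
    intro r hr
    cases hr with
    | isometry p =>
      simpa only [map_sub, map_mul, map_star, map_one, hV] using hrel (.isometry (f p))
    | selfAdjoint X hX =>
      simpa only [map_sub, map_star, hP] using hrel (.selfAdjoint (E X) (hE X hX))
    | idempotent X hX =>
      simpa only [map_sub, map_mul, hP] using hrel (.idempotent (E X) (hE X hX))
    | mul p q =>
      simpa only [map_sub, map_mul, hV] using hrel (.mul (f p) (f q))
    | conj p X hX =>
      have := hrel (.conj (f p) (E X) (hE X hX))
      rw [← hcongr (image p X hX) (hE _ (hX.image p))] at this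
      simpa only [map_sub, map_mul, map_star, hV, hP] using this
    | univ =>
      have := hrel .univ
      rw [← hcongr univ (hE _ .univ)] at this
      simpa only [map_sub, map_one, hP] using this
    | empty =>
      have := hrel .empty
      rw [← hcongr empty (hE _ .empty)] at this
      simpa only [hP] using this
    | inter X Y hX hY =>
      have := hrel (.inter (E X) (E Y) (hE X hX) (hE Y hY))
      rw [← hcongr (inter X Y hX hY) (hE _ (hX.inter hY))] at this
      simpa only [map_sub, map_mul, hP] using this)
  exact ⟨Φ, fun p => (hΦ _).trans (hV p)⟩

end SemigroupCStarAlgebra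

/-! ### Extension of ideals along a pure flat extension -/

section Extension

variable {R S : Type*} [CommRing R] [CommRing S] (φ : R →+* S)

/-- The equational criterion for flatness of `S / φ(R)`, lifted to `S`. -/
lemma exists_factorization_of_flat_quotient (hφ : Function.Injective φ)
    (hflat : Module.Flat φ.range (S ⧸ LinearMap.range (Algebra.linearMap φ.range S)))
    {ι : Type*} [Fintype ι] {f : ι → R} {s : ι → S} {r : R} (h : ∑ i, φ (f i) * s i = φ r) :
    ∃ (k : ℕ) (a : ι → Fin k → R) (y : Fin k → S) (t : ι → R),
      (∀ i, s i = ∑ j, φ (a i j) * y j + φ (t i)) ∧ (∀ j, ∑ i, f i * a i j = 0) ∧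
        ∑ i, f i * t i = r := by
  set N := LinearMap.range (Algebra.linearMap φ.range S)
  have hsmul : ∀ (x : R) (z : S), φ.rangeRestrict x • z = φ x * z := fun _ _ => rfl
  have hN : ∀ z, z ∈ N → ∃ x, φ x = z := by
    rintro _ ⟨⟨_, x, rfl⟩, rfl⟩
    exact ⟨x, rfl⟩
  -- Modulo `φ(R)` the right-hand side `φ r` vanishes, so the `s i` satisfy a linear relation in the
  -- flat quotient.
  have hrel : ∑ i, φ.rangeRestrict (f i) • N.mkQ (s i) = 0 := by
    simp only [← map_smul, ← map_sum, hsmul]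
    rw [h, Submodule.mkQ_apply, Submodule.Quotient.mk_eq_zero]
    exact ⟨φ.rangeRestrict r, rfl⟩
  obtain ⟨k, a, y, hy, ha⟩ := Module.Flat.isTrivialRelation_of_sum_smul_eq_zero hrel
  choose a' ha' using fun i j => φ.rangeRestrict_surjective (a i j)
  choose y' hy' using fun j => N.mkQ_surjective (y j)
  -- The trivialization holds only modulo `φ(R)`; the error of the lifted identity is the correction
  -- `t i`.
  have hdiff : ∀ i, ∃ x, φ x = s i - ∑ j, φ (a' i j) * y' j := fun i => by
    refine hN _ ?_
    rw [← Submodule.Quotient.mk_eq_zero, ← Submodule.mkQ_apply, map_sub, sub_eq_zero]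
    refine (hy i).trans ?_
    simp only [← hsmul, map_sum, map_smul, ha', hy']
  choose t ht using hdiff
  have hs : ∀ i, s i = ∑ j, φ (a' i j) * y' j + φ (t i) := fun i => by rw [ht]; ring
  have hz : ∀ j, ∑ i, f i * a' i j = 0 := fun j => by
    have hz' : φ.rangeRestrict (∑ i, f i * a' i j) = 0 := by
      rw [map_sum]
      simpa only [map_mul, ha'] using ha j
    exact hφ ((congrArg Subtype.val hz').trans (map_zero φ).symm)
  -- After substituting `hs` into `h`, the `y'` terms cancel by `hz`; injectivity of `φ` descends
  -- what is left to `R`.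
  refine ⟨k, a', y', t, hs, hz, hφ ?_⟩
  rw [← h, map_sum]
  simp only [map_mul]
  rw [Finset.sum_congr rfl fun i _ => congrArg (φ (f i) * ·) (hs i)]
  simp only [mul_add, Finset.sum_add_distrib, Finset.mul_sum]
  rw [Finset.sum_comm]
  simp only [← mul_assoc, ← map_mul, ← Finset.sum_mul, ← map_sum, hz]
  simp

lemma Ideal.exists_sum_of_mem_map {I : Ideal R} {x : S} (hx : x ∈ I.map φ) :
    ∃ (n : ℕ) (f : Fin n → R) (s : Fin n → S), (∀ i, f i ∈ I) ∧ ∑ i, φ (f i) * s i = x := by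
  obtain ⟨n, s, g, rfl⟩ := Submodule.mem_span_set'.1 hx
  choose f hf hfg using fun i => (g i).2
  exact ⟨n, f, s, hf, Finset.sum_congr rfl fun i _ => by
    rw [hfg, smul_eq_mul, mul_comm]⟩

/-- Writing `φ r = ∑ φ(f i) * s i` with `f i ∈ I`, the factorization replaces the coefficients `s i`
by elements `t i` of `R`. -/
lemma Ideal.mem_of_map_mem_map (hφ : Function.Injective φ)
    (hflat : Module.Flat φ.range (S ⧸ LinearMap.range (Algebra.linearMap φ.range S)))
    {I : Ideal R} {r : R} (h : φ r ∈ I.map φ) : r ∈ I := by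
  obtain ⟨n, f, s, hf, hs⟩ := Ideal.exists_sum_of_mem_map φ h
  obtain ⟨k, a, y, t, -, -, rfl⟩ := exists_factorization_of_flat_quotient φ hφ hflat hs
  exact I.sum_mem fun i _ => I.mul_mem_right _ (hf i)

/-- Two expressions of `x`, one over `I` and one over `J`, differ by a relation with value zero. Its
trivialization rewrites `x` through syzygies over `R`, each of which yields an element of `I ∩ J`.
-/
lemma Ideal.map_inf_of_flat_quotient (hφ : Function.Injective φ)
    (hflat : Module.Flat φ.range (S ⧸ LinearMap.range (Algebra.linearMap φ.range S)))
    (I J : Ideal R) : (I ⊓ J).map φ = I.map φ ⊓ J.map φ := by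
  refine le_antisymm (Ideal.map_inf_le φ) fun x hx => ?_
  obtain ⟨m, f, s, hf, hs⟩ := Ideal.exists_sum_of_mem_map φ hx.1
  obtain ⟨n, g, u, hg, hu⟩ := Ideal.exists_sum_of_mem_map φ hx.2
  have h : ∑ i, φ (Sum.elim f (-g) i) * Sum.elim s u i = φ 0 := by
    simp [Fintype.sum_sum_type, hs, hu]
  obtain ⟨k, a, y, t, hst, ha, ht⟩ := exists_factorization_of_flat_quotient φ hφ hflat h
  -- A syzygy `b` of `(f, -g)` says that `∑ f i * b i` over the first block equals `∑ g j * b j`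
  -- over the second, so this element lies in both ideals.
  have hI : ∀ b : Fin m ⊕ Fin n → R, ∑ i, Sum.elim f (-g) i * b i = 0 →
      ∑ i, f i * b (.inl i) ∈ I ⊓ J := fun b hb => by
    refine ⟨I.sum_mem fun i _ => I.mul_mem_right _ (hf i), ?_⟩
    have : ∑ i, f i * b (.inl i) = ∑ j, g j * b (.inr j) := by
      simpa [Fintype.sum_sum_type, ← sub_eq_add_neg, sub_eq_zero] using hb
    rw [this]
    exact J.sum_mem fun i _ => J.mul_mem_right _ (hg i)
  have hs' : ∀ i, s i = ∑ j, φ (a (.inl i) j) * y j + φ (t (.inl i)) := fun i => hst (.inl i)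
  have hx' : x = ∑ j, φ (∑ i, f i * a (.inl i) j) * y j + φ (∑ i, f i * t (.inl i)) := by
    rw [← hs, Finset.sum_congr rfl fun i _ => congrArg (φ (f i) * ·) (hs' i)]
    simp only [mul_add, Finset.sum_add_distrib, Finset.mul_sum]
    rw [Finset.sum_comm]
    simp only [← mul_assoc, ← map_mul, ← Finset.sum_mul, ← map_sum]
  rw [hx']
  exact Ideal.add_mem _ (Ideal.sum_mem _ fun j _ => Ideal.mul_mem_right _ _
    (Ideal.mem_map_of_mem φ (hI _ (ha j)))) (Ideal.mem_map_of_mem φ (hI _ ht))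

end Extension

/-! ### Constructible ideals of the `ax+b`-semigroup -/

namespace AxbSemigroup

variable {R S : Type*} [CommRing R] [CommRing S]

/-- The right ideal `(r + I) × (I \ {0})` of the `ax+b`-semigroup. -/
def cosetIdeal (r : R) (I : Ideal R) : Set (AxbSemigroup R) := {x | x.b - r ∈ I ∧ x.a ∈ I}

lemma cosetIdeal_top (r : R) : cosetIdeal r ⊤ = Set.univ :=
  Set.eq_univ_of_forall fun _ => ⟨trivial, trivial⟩

lemma cosetIdeal_bot (r : R) : cosetIdeal r ⊥ = ∅ :=
  Set.eq_empty_of_forall_notMem fun x hx => x.a_ne_zero hx.2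

/-- A common point `t` can serve as the base point of both cosets. -/
lemma inter_cosetIdeal {r s t : R} {I J : Ideal R} (hI : t - r ∈ I) (hJ : t - s ∈ J) :
    cosetIdeal r I ∩ cosetIdeal s J = cosetIdeal t (I ⊓ J) := by
  have key : ∀ {r : R} {I : Ideal R}, t - r ∈ I → ∀ b, b - r ∈ I ↔ b - t ∈ I := by
    intro r I h b
    rw [← sub_add_sub_cancel b t r]
    exact I.add_mem_iff_left h
  ext x
  simp only [cosetIdeal, Set.mem_inter_iff, Set.mem_ofPred_eq, Submodule.mem_inf, key hI, key hJ]
  tauto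

lemma inter_cosetIdeal_eq_empty {r s : R} {I J : Ideal R} (h : r - s ∉ I ⊔ J) :
    cosetIdeal r I ∩ cosetIdeal s J = ∅ := by
  refine Set.eq_empty_of_forall_notMem fun x hx => h ?_
  rw [← sub_add_sub_cancel r x.b s, ← neg_sub]
  exact Ideal.add_mem _ (neg_mem (Ideal.mem_sup_left hx.1.1)) (Ideal.mem_sup_right hx.2.1)

lemma exists_sub_mem_of_sub_mem_sup {r s : R} {I J : Ideal R} (h : r - s ∈ I ⊔ J) :
    ∃ t, t - r ∈ I ∧ t - s ∈ J := by
  obtain ⟨i, hi, j, hj, hij⟩ := Submodule.mem_sup.1 h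
  -- From `r - s = i + j`, the point `r - i = s + j` lies in both cosets.
  refine ⟨r - i, ?_, ?_⟩
  · simpa using hi
  · convert hj using 1
    linear_combination -hij

lemma exists_inter_cosetIdeal_eq (r s : R) (I J : Ideal R) :
    ∃ t K, cosetIdeal r I ∩ cosetIdeal s J = cosetIdeal t K := by
  by_cases h : r - s ∈ I ⊔ J
  · obtain ⟨t, hI, hJ⟩ := exists_sub_mem_of_sub_mem_sup h
    exact ⟨t, _, inter_cosetIdeal hI hJ⟩
  -- The empty set counts as a coset ideal, that of the zero ideal, since second coordinates are
  -- nonzero.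
  · exact ⟨0, ⊥, by rw [inter_cosetIdeal_eq_empty h, cosetIdeal_bot]⟩

/-- The extension of a right ideal of the `ax+b`-semigroup of `R` along `φ : R →+* S`; it sends
`(r + I) × (I \ {0})` to `(φ r + I S) × (I S \ {0})`. -/
def extend (φ : R →+* S) (X : Set (AxbSemigroup R)) : Set (AxbSemigroup S) :=
  ⋃ x ∈ X, cosetIdeal (φ x.b) ((Ideal.span (AxbSemigroup.a '' X)).map φ)

lemma extend_empty (φ : R →+* S) : extend φ (∅ : Set (AxbSemigroup R)) = ∅ := by
  simp [extend]

/-- For `I ≠ 0`, the second coordinates recover `I`, and every base point `x` in the union gives the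
same coset, as `φ x.b - φ r ∈ IS`. For `I = 0` both sides are empty. -/
lemma extend_cosetIdeal (φ : R →+* S) (r : R) (I : Ideal R) :
    extend φ (cosetIdeal r I) = cosetIdeal (φ r) (I.map φ) := by
  rcases eq_or_ne I ⊥ with rfl | hI
  · simp [extend, cosetIdeal_bot, Ideal.map_bot]
  · have hspan : Ideal.span (AxbSemigroup.a '' cosetIdeal r I) = I := by
      refine le_antisymm (Ideal.span_le.2 ?_) fun a ha => ?_
      · rintro _ ⟨x, hx, rfl⟩
        exact hx.2
      · rcases eq_or_ne a 0 with rfl | h0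
        · exact zero_mem _
        · exact Ideal.subset_span ⟨⟨r, a, h0⟩, ⟨by simp, ha⟩, rfl⟩
    -- A nonzero `a ∈ I` supplies the point `(r, a)`, so that the union is not empty.
    obtain ⟨a, ha, h0⟩ := Submodule.exists_mem_ne_zero_of_ne_bot hI
    ext y
    simp only [extend, hspan, Set.mem_iUnion, exists_prop]
    constructor
    · rintro ⟨x, hx, hb, hc⟩
      refine ⟨?_, hc⟩
      rw [← sub_add_sub_cancel y.b (φ x.b) (φ r), ← map_sub]
      exact Ideal.add_mem _ hb (Ideal.mem_map_of_mem φ hx.1)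
    · intro hy
      exact ⟨⟨r, a, h0⟩, ⟨by simp, ha⟩, hy⟩

lemma extend_univ (φ : R →+* S) : extend φ (Set.univ : Set (AxbSemigroup R)) = Set.univ := by
  rw [← cosetIdeal_top 0, extend_cosetIdeal, Ideal.map_top, cosetIdeal_top]

variable [IsDomain R]

lemma mul_b (x y : AxbSemigroup R) : (x * y).b = x.b + x.a * y.b := rfl

lemma mul_a (x y : AxbSemigroup R) : (x * y).a = x.a * y.a := rfl

lemma image_cosetIdeal (p : AxbSemigroup R) (r : R) (I : Ideal R) :
    (fun x => p * x) '' cosetIdeal r I =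
      cosetIdeal (p.b + p.a * r) (Ideal.span {p.a} * I) := by
  ext x
  simp only [cosetIdeal, Set.mem_image, Set.mem_ofPred_eq, Ideal.mem_span_singleton_mul]
  constructor
  · rintro ⟨y, ⟨hb, ha⟩, rfl⟩
    exact ⟨⟨_, hb, by rw [mul_b]; ring⟩, ⟨_, ha, rfl⟩⟩
  · rintro ⟨⟨d, hd, hd'⟩, ⟨c, hc, hc'⟩⟩
    refine ⟨⟨d + r, c, ?_⟩, ⟨by simpa using hd, hc⟩, AxbSemigroup.ext ?_ hc'⟩
    · rintro rfl
      exact x.a_ne_zero (by rw [← hc', mul_zero])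
    · rw [mul_b]
      linear_combination hd'

lemma exists_preimage_cosetIdeal_eq (p : AxbSemigroup R) (r : R) (I : Ideal R) :
    ∃ t K, (fun x => p * x) ⁻¹' cosetIdeal r I = cosetIdeal t K := by
  by_cases h : ∃ t, p.b + p.a * t - r ∈ I
  · obtain ⟨t, ht⟩ := h
    -- Once one solution `t` exists, the others differ from it by elements of the colon ideal `{y |
    -- p.a * y ∈ I}`, which also governs the second coordinate.
    refine ⟨t, Submodule.comap (LinearMap.mulLeft R p.a) I, ?_⟩
    ext x
    simp only [cosetIdeal, Set.mem_preimage, Set.mem_ofPred_eq, Submodule.mem_comap,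
      LinearMap.mulLeft_apply, mul_b, mul_a]
    have : p.b + p.a * x.b - r = p.a * (x.b - t) + (p.b + p.a * t - r) := by ring
    rw [this, I.add_mem_iff_left ht]
  · refine ⟨0, ⊥, ?_⟩
    rw [cosetIdeal_bot]
    exact Set.eq_empty_of_forall_notMem fun x hx => h ⟨x.b, hx.1⟩

lemma exists_eq_cosetIdeal {X : Set (AxbSemigroup R)} (hX : IsConstructible X) :
    ∃ r I, X = cosetIdeal r I := by
  induction hX with
  | univ => exact ⟨0, ⊤, (cosetIdeal_top 0).symm⟩
  | empty => exact ⟨0, ⊥, (cosetIdeal_bot 0).symm⟩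
  | image p _ ih =>
    obtain ⟨r, I, rfl⟩ := ih
    exact ⟨_, _, image_cosetIdeal p r I⟩
  | preimage p _ ih =>
    obtain ⟨r, I, rfl⟩ := ih
    exact exists_preimage_cosetIdeal_eq p r I
  | inter _ _ h₁ h₂ =>
    obtain ⟨r, I, rfl⟩ := h₁
    obtain ⟨s, J, rfl⟩ := h₂
    exact exists_inter_cosetIdeal_eq r s I J

/-- Meeting cosets reduce to `(I ∩ J)S = IS ∩ JS`; disjoint ones stay disjoint because `(I + J)S`
contracts to `I + J`. -/
lemma extend_inter (φ : R →+* S) (hφ : Function.Injective φ)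
    (hflat : Module.Flat φ.range (S ⧸ LinearMap.range (Algebra.linearMap φ.range S)))
    {X Y : Set (AxbSemigroup R)} (hX : IsConstructible X)
    (hY : IsConstructible Y) : extend φ (X ∩ Y) = extend φ X ∩ extend φ Y := by
  obtain ⟨r, I, rfl⟩ := exists_eq_cosetIdeal hX
  obtain ⟨s, J, rfl⟩ := exists_eq_cosetIdeal hY
  by_cases h : r - s ∈ I ⊔ J
  · obtain ⟨t, hI, hJ⟩ := exists_sub_mem_of_sub_mem_sup h
    rw [inter_cosetIdeal hI hJ, extend_cosetIdeal, extend_cosetIdeal, extend_cosetIdeal,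
      Ideal.map_inf_of_flat_quotient φ hφ hflat, inter_cosetIdeal (t := φ t)]
    · rw [← map_sub]
      exact Ideal.mem_map_of_mem φ hI
    · rw [← map_sub]
      exact Ideal.mem_map_of_mem φ hJ
  · rw [inter_cosetIdeal_eq_empty h, extend_empty, extend_cosetIdeal, extend_cosetIdeal,
      inter_cosetIdeal_eq_empty]
    rw [← map_sub, ← Ideal.map_sup]
    exact fun h' => h (Ideal.mem_of_map_mem_map φ hφ hflat h')

variable [IsDomain S] (φ : R →+* S)

lemma extend_image (hφ : Function.Injective φ) (p : AxbSemigroup R) {X : Set (AxbSemigroup R)}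
    (hX : IsConstructible X) :
    extend φ ((fun x => p * x) '' X) = (fun x => map φ hφ p * x) '' extend φ X := by
  obtain ⟨r, I, rfl⟩ := exists_eq_cosetIdeal hX
  rw [image_cosetIdeal, extend_cosetIdeal, extend_cosetIdeal, image_cosetIdeal, Ideal.map_mul,
    Ideal.map_span, Set.image_singleton, map_add, map_mul]
  rfl

/-- Apply left translation by the image of `p`, which is injective: since `p(p⁻¹X) = X ∩ pP`, the
claim follows from the cases of translates and intersections. No relation of `C*(P)` mentions
preimages; this serves only to show that extensions are constructible. -/
lemma extend_preimage (hφ : Function.Injective φ)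
    (hflat : Module.Flat φ.range (S ⧸ LinearMap.range (Algebra.linearMap φ.range S)))
    (p : AxbSemigroup R) {X : Set (AxbSemigroup R)} (hX : IsConstructible X) :
    extend φ ((fun x => p * x) ⁻¹' X) = (fun x => map φ hφ p * x) ⁻¹' extend φ X := by
  refine (mul_right_injective (map φ hφ p)).image_injective ?_
  rw [← extend_image φ hφ p (hX.preimage p), Set.image_preimage_eq_inter_range,
    Set.image_preimage_eq_inter_range, ← Set.image_univ, ← Set.image_univ,
    extend_inter φ hφ hflat hX (.image p .univ), extend_image φ hφ p .univ, extend_univ]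

lemma isConstructible_extend (hφ : Function.Injective φ)
    (hflat : Module.Flat φ.range (S ⧸ LinearMap.range (Algebra.linearMap φ.range S)))
    {X : Set (AxbSemigroup R)} (hX : IsConstructible X) :
    IsConstructible (extend φ X) := by
  induction hX with
  | univ => exact extend_univ φ ▸ .univ
  | empty => exact extend_empty φ ▸ .empty
  | image p hX ih => exact extend_image φ hφ p hX ▸ ih.image _
  | preimage p hX ih => exact extend_preimage φ hφ hflat p hX ▸ ih.preimage _
  | inter hX hY h₁ h₂ => exact extend_inter φ hφ hflat hX hY ▸ h₁.inter h₂

end AxbSemigroup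

theorem mainTheorem11 {R : Type*} {S : Type*} [CommRing R] [IsDomain R] [CommRing S] [IsDomain S]
    (φ : R →+* S) (hφ : Function.Injective φ)
    (hflat : Module.Flat φ.range (S ⧸ LinearMap.range (Algebra.linearMap φ.range S))) :
    ∃ Φ : SemigroupCStarAlgebra (AxbSemigroup R) →⋆ₐ[ℂ] SemigroupCStarAlgebra (AxbSemigroup S),
      ∀ p : AxbSemigroup R,
        Φ (SemigroupCStarAlgebra.v p) = SemigroupCStarAlgebra.v (AxbSemigroup.map φ hφ p) := by
  exact SemigroupCStarAlgebra.exists_starAlgHom (AxbSemigroup.map φ hφ) (AxbSemigroup.extend φ)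
    (fun _ => AxbSemigroup.isConstructible_extend φ hφ hflat) (AxbSemigroup.extend_univ φ)
    (AxbSemigroup.extend_empty φ) (fun p _ => AxbSemigroup.extend_image φ hφ p)
    (fun _ _ => AxbSemigroup.extend_inter φ hφ hflat)
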